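/- Let $X$ be a non-empty set of arbitrary cardinality and let $(X,r)$, $r(x,y)=({}^xy,x^y)$, be a \emph{solution}, i.e. an involutive non-degenerate set-theoretic solution of the Yang–Baxter equation: $r^2=\mathrm{id}$, all maps $\mathcal L_x:y\mapsto {}^xy$ and $\mathcal R_x:y\mapsto y^x$ are bijective, and $r^{12}r^{23}r^{12}=r^{23}r^{12}r^{23}$ on $X^3$. It is \emph{trivial} if $r(x,y)=(y,x)$ for all $x,y$, and it satisfies \textbf{lri} if $({}^xy)^x=y={}^x(y^x)$ for all $x,y$. Its retraction $\mathrm{Ret}(X,r)$ is the solution induced by $r$ on $X/{\sim}$, where $x\sim y$ iff $\mathcal L_x=\mathcal L_y$; $(X,r)$ is a multipermutation solution of level $m$, written $\mathrm{mpl}(X,r)=m$, if $m\ge 0$ is the least integer such that $\mathrm{Ret}^m(X,r)$ has exactly one element. Let $G=G(X,r)$ be the structure group, generated by $X$ with defining relations $xy=({}^xy)(x^y)$ for $x,y\in X$. Let $r_G:G\times G\to G\times G$, $r_G(a,b)=({}^ab,a^b)$, be the unique braiding operator on $G$ that restricts to $r$ on $X\times X$; that is, $r_G$ is bijective and, for all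 $a,b,u,v\in G$, ${}^a1=1$, ${}^1u=u$, $1^u=1$, $a^1=a$, ${}^{ab}u={}^a({}^bu)$, $a^{uv}=(a^u)^v$, ${}^a(uv)=({}^au)({}^{a^u}v)$, $(ab)^u=(a^{{}^bu})(b^u)$, $uv=({}^uv)(u^v)$. Then $(G,r_G)$ is itself a solution. Let $(G,+,\cdot)$ be the associated left brace, $a+b=a\cdot({}^{a^{-1}}b)$; it satisfies \textbf{Raut} if $(a+b)^c=a^c+b^c$ for all $a,b,c\in G$. The following conditions are equivalent. \begin{enumerate} \item $(G,r_G)$ is a non-trivial solution with condition \textbf{lri}. \item $(G,r_G)$ is a multipermutation solution of level $2$. \item $G$ acts non-trivially upon itself as automorphisms, that is, $\mathcal L_{(a^b)}=\mathcal L_a$ for all $a,b\in G$, and $\mathcal L_a\neq \mathrm{id}_G$ for some $a\in G$ (where $\mathcal L_a(b)={}^ab$). \item $(X,r)$ is a non-trivial solution with \textbf{lri}, and the left brace $(G,+,\cdot)$ satisfies \textbf{Raut}. \end{enumerate} Each of these conditions implies that $(X,r)$ is a multipermutation solution with $\mathrm{mpl}(X,r)\le 2$. -/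

import Mathlib

universe u

namespace YangBaxter

/-- The left component `ˣy` of `r (x, y) = (ˣy, xʸ)`. -/
abbrev lact {X : Type u} (r : X × X → X × X) (x y : X) : X := (r (x, y)).1

/-- The right component `xʸ` of `r (x, y) = (ˣy, xʸ)`. -/
abbrev ract {X : Type u} (r : X × X → X × X) (x y : X) : X := (r (x, y)).2

/-- `r × id` on `X × X × X`. -/
def r12 {X : Type u} (r : X × X → X × X) (t : X × X × X) : X × X × X :=
  ((r (t.1, t.2.1)).1, (r (t.1, t.2.1)).2, t.2.2)

/-- `id × r` on `X × X × X`. -/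
def r23 {X : Type u} (r : X × X → X × X) (t : X × X × X) : X × X × X :=
  (t.1, r t.2)

/-- An involutive non-degenerate set-theoretic solution of the Yang–Baxter equation on `X`. -/
structure Solution (X : Type u) where
  r : X × X → X × X
  involutive : Function.Involutive r
  left_bijective : ∀ x, Function.Bijective fun y => lact r x y
  right_bijective : ∀ x, Function.Bijective fun y => ract r y x
  braid : ∀ t, r12 r (r23 r (r12 r t)) = r23 r (r12 r (r23 r t))

namespace Solution

variable {X : Type u} (S : Solution X)

/-- The trivial solution is the flip. -/
def IsTrivial : Prop := ∀ x y, S.r (x, y) = (y, x)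

/-- Condition **lri**: `(ˣy)ˣ = y = ˣ(yˣ)`. -/
def Lri : Prop := ∀ x y, ract S.r (lact S.r x y) x = y ∧ lact S.r x (ract S.r y x) = y

theorem ll (x y : X) : lact S.r (lact S.r x y) (ract S.r x y) = x :=
  congrArg Prod.fst (S.involutive (x, y))

theorem rr (x y : X) : ract S.r (lact S.r x y) (ract S.r x y) = y :=
  congrArg Prod.snd (S.involutive (x, y))

theorem braid1 (x y z : X) :
    lact S.r (lact S.r x y) (lact S.r (ract S.r x y) z) = lact S.r x (lact S.r y z) :=
  congrArg (fun t => t.1) (S.braid (x, y, z))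

theorem braid3 (x y z : X) :
    ract S.r (ract S.r x y) z = ract S.r (ract S.r x (lact S.r y z)) (ract S.r y z) :=
  congrArg (fun t => t.2.2) (S.braid (x, y, z))

/-- The permutation `𝓛ₓ : y ↦ ˣy`. -/
noncomputable def L (x : X) : Equiv.Perm X := Equiv.ofBijective _ (S.left_bijective x)

/-- The permutation `𝓡ₓ : y ↦ yˣ`. -/
noncomputable def R (x : X) : Equiv.Perm X := Equiv.ofBijective _ (S.right_bijective x)

@[simp] theorem L_apply (x y : X) : S.L x y = lact S.r x y := rfl

@[simp] theorem R_apply (x y : X) : S.R x y = ract S.r y x := rfl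

theorem L_mul (x y : X) : S.L x * S.L y = S.L (lact S.r x y) * S.L (ract S.r x y) := by
  ext z; simpa using (S.braid1 x y z).symm

theorem R_mul (x y : X) : S.R y * S.R x = S.R (ract S.r x y) * S.R (lact S.r x y) := by
  ext z; simpa using S.braid3 z x y

theorem ract_eq (x y : X) : ract S.r x y = (S.L (lact S.r x y)).symm x := by
  rw [Equiv.eq_symm_apply]; exact S.ll x y

theorem lact_eq (x y : X) : lact S.r x y = (S.R (ract S.r x y)).symm y := by
  rw [Equiv.eq_symm_apply]; exact S.rr x y

/-- Cycle set identity, in the form `𝓛ₚ 𝓛_{p·q} = 𝓛_q 𝓛_{q·p}` with `p·q = 𝓛ₚ⁻¹ q`. -/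
theorem L_cycle (p q : X) :
    S.L p * S.L ((S.L p).symm q) = S.L q * S.L ((S.L q).symm p) := by
  have h : lact S.r p ((S.L p).symm q) = q := (S.L p).apply_symm_apply q
  rw [L_mul, ract_eq, h]

theorem R_cycle (p q : X) :
    S.R p * S.R ((S.R p).symm q) = S.R q * S.R ((S.R q).symm p) := by
  have h : ract S.r ((S.R p).symm q) p = q := (S.R p).apply_symm_apply q
  rw [R_mul, lact_eq, h]

/-- The diagonal map `y ↦ 𝓛_y⁻¹ y`, a bijection with inverse `y ↦ 𝓡_y⁻¹ y`. -/
noncomputable def diag : Equiv.Perm X where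
  toFun y := (S.L y).symm y
  invFun y := (S.R y).symm y
  left_inv y := by
    rw [Equiv.symm_apply_eq]
    have h : lact S.r y ((S.L y).symm y) = y := (S.L y).apply_symm_apply y
    change _ = ract S.r y ((S.L y).symm y)
    rw [ract_eq, h]
  right_inv y := by
    rw [Equiv.symm_apply_eq]
    have h : ract S.r ((S.R y).symm y) y = y := (S.R y).apply_symm_apply y
    change _ = lact S.r ((S.R y).symm y) y
    rw [lact_eq, h]

theorem diag_apply (y : X) : S.diag y = (S.L y).symm y := rfl

theorem diag_ract (q v : X) : S.diag (ract S.r q v) = (S.L v).symm (S.diag q) := by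
  -- put `p = ^q v`, so that `q^v = p·q` and `v = q·p`
  have h1 := S.ract_eq q v
  have h2 : v = (S.L q).symm (lact S.r q v) := ((S.L q).symm_apply_apply v).symm
  generalize lact S.r q v = p at h1 h2
  have h := S.L_cycle p q
  rw [← h1, ← h2] at h
  have h3 := DFunLike.congr_fun (congrArg (·⁻¹) h) q
  simp only [mul_inv_rev, Equiv.Perm.mul_apply, Equiv.Perm.inv_def] at h3
  rw [← h1] at h3
  exact h3

/-- The retraction relation `x ∼ y ↔ 𝓛ₓ = 𝓛_y`. -/
def retSetoid : Setoid X where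
  r x y := S.L x = S.L y
  iseqv := ⟨fun _ => rfl, Eq.symm, Eq.trans⟩

theorem R_eq_of_L_eq {x y : X} (h : S.L x = S.L y) : S.R x = S.R y := by
  ext q
  apply S.diag.injective
  simp [diag_ract, h]

theorem L_eq_of_R_eq {x y : X} (h : S.R x = S.R y) : S.L x = S.L y := by
  suffices (S.L x)⁻¹ = (S.L y)⁻¹ from inv_injective this
  ext q
  obtain ⟨q, rfl⟩ := S.diag.surjective q
  have := S.diag_ract q x
  have h' : ract S.r q x = ract S.r q y := DFunLike.congr_fun h q
  rw [h', diag_ract] at this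
  exact this.symm

theorem ret_L_symm (p : X) {q q' : X} (h : S.L q = S.L q') :
    S.L ((S.L p).symm q) = S.L ((S.L p).symm q') := by
  have h1 := S.L_cycle p q
  rw [h, ← S.L_cycle p q'] at h1
  exact mul_left_cancel h1

theorem ret_R_symm (p : X) {q q' : X} (h : S.L q = S.L q') :
    S.L ((S.R p).symm q) = S.L ((S.R p).symm q') := by
  apply S.L_eq_of_R_eq
  have h1 := S.R_cycle p q
  rw [S.R_eq_of_L_eq h, ← S.R_cycle p q'] at h1
  exact mul_left_cancel h1

theorem ret_lact {x x' y y' : X} (hx : S.L x = S.L x') (hy : S.L y = S.L y') :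
    S.L (lact S.r x y) = S.L (lact S.r x' y') := by
  have e : lact S.r x y = lact S.r x' y := DFunLike.congr_fun hx y
  have e2 : ract S.r x' y = ract S.r x' y' := DFunLike.congr_fun (S.R_eq_of_L_eq hy) x'
  rw [e, lact_eq, lact_eq S x' y', e2]
  exact S.ret_R_symm _ hy

theorem ret_ract {x x' y y' : X} (hx : S.L x = S.L x') (hy : S.L y = S.L y') :
    S.L (ract S.r x y) = S.L (ract S.r x' y') := by
  have h := S.ret_lact hx hy
  rw [ract_eq, ract_eq S x' y', h]
  exact S.ret_L_symm _ hx

/-- The map induced by `r` on the set of `∼`-classes: `r ([x], [y]) = ([ˣy], [xʸ])`. -/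
def retMap : Quotient S.retSetoid × Quotient S.retSetoid →
    Quotient S.retSetoid × Quotient S.retSetoid :=
  fun p =>
    (Quotient.map₂ (lact S.r) (fun _ _ hx _ _ hy => S.ret_lact hx hy) p.1 p.2,
      Quotient.map₂ (ract S.r) (fun _ _ hx _ _ hy => S.ret_ract hx hy) p.1 p.2)

theorem retMap_mk (x y : X) :
    S.retMap (Quotient.mk S.retSetoid x, Quotient.mk S.retSetoid y) =
      (Quotient.mk S.retSetoid (lact S.r x y), Quotient.mk S.retSetoid (ract S.r x y)) := rfl

/-- The retraction `Ret (X, r)`. -/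
def retract : Solution (Quotient S.retSetoid) where
  r := S.retMap
  involutive := by
    rintro ⟨x, y⟩
    induction x using Quotient.inductionOn
    induction y using Quotient.inductionOn
    simp only [retMap_mk, S.ll, S.rr]
  left_bijective x := by
    induction x using Quotient.inductionOn with | _ x
    constructor
    · intro y z h
      induction y using Quotient.inductionOn with | _ y
      induction z using Quotient.inductionOn with | _ z
      have h' : S.L (S.L x y) = S.L (S.L x z) := Quotient.exact h
      have := S.ret_L_symm x h'
      simp only [Equiv.symm_apply_apply] at this
      exact Quotient.sound this
    · intro y
      induction y using Quotient.inductionOn with | _ y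
      refine ⟨Quotient.mk _ ((S.L x).symm y), ?_⟩
      change Quotient.mk S.retSetoid (S.L x ((S.L x).symm y)) = _
      simp only [Equiv.apply_symm_apply]
  right_bijective x := by
    induction x using Quotient.inductionOn with | _ x
    constructor
    · intro y z h
      induction y using Quotient.inductionOn with | _ y
      induction z using Quotient.inductionOn with | _ z
      have h' : S.L (S.R x y) = S.L (S.R x z) := Quotient.exact h
      have := S.ret_R_symm x h'
      simp only [Equiv.symm_apply_apply] at this
      exact Quotient.sound this
    · intro y
      induction y using Quotient.inductionOn with | _ y
      refine ⟨Quotient.mk _ ((S.R x).symm y), ?_⟩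
      change Quotient.mk S.retSetoid (S.R x ((S.R x).symm y)) = _
      simp only [Equiv.apply_symm_apply]
  braid := by
    rintro ⟨x, y, z⟩
    induction x using Quotient.inductionOn with | _ x
    induction y using Quotient.inductionOn with | _ y
    induction z using Quotient.inductionOn with | _ z
    exact congrArg (fun t : X × X × X =>
      ((Quotient.mk S.retSetoid t.1, Quotient.mk S.retSetoid t.2.1,
        Quotient.mk S.retSetoid t.2.2) :
        Quotient S.retSetoid × Quotient S.retSetoid × Quotient S.retSetoid)) (S.braid (x, y, z))

/-- `S.RetIsPoint m`: the `m`-fold retraction `Retᵐ (X, r)` has exactly one element. -/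
def RetIsPoint : ℕ → ∀ {X : Type u}, Solution X → Prop
  | 0, X, _ => Nat.card X = 1
  | m + 1, _, S => RetIsPoint m S.retract

/-- `(X, r)` is a multipermutation solution of level `m`: `m` is the least number such that
`Retᵐ (X, r)` has exactly one element. -/
def HasMpl (m : ℕ) : Prop := IsLeast {k | RetIsPoint k S} m

end Solution

/-- A braiding operator on a group. -/
structure IsBraidingOperator {G : Type u} [Group G] (r : G × G → G × G) : Prop where
  bijective : Function.Bijective r
  ml0 : ∀ a, lact r a 1 = 1
  ml0' : ∀ u, lact r 1 u = u
  mr0 : ∀ u, ract r 1 u = 1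
  mr0' : ∀ a, ract r a 1 = a
  ml1 : ∀ a b u, lact r (a * b) u = lact r a (lact r b u)
  mr1 : ∀ a u v, ract r a (u * v) = ract r (ract r a u) v
  ml2 : ∀ a u v, lact r a (u * v) = lact r a u * lact r (ract r a u) v
  mr2 : ∀ a b u, ract r (a * b) u = ract r a (lact r b u) * ract r b u
  m3 : ∀ u v, u * v = lact r u v * ract r u v

/-- A symmetric group (in the sense of Takeuchi) on the group `G`: an involutive braiding
operator. -/
structure SymmetricGroup (G : Type u) [Group G] where
  r : G × G → G × G
  isBraidingOperator : IsBraidingOperator r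
  involutive : Function.Involutive r

/-- A left brace with multiplicative group `G`. -/
structure LeftBrace (G : Type u) [Group G] where
  add : G → G → G
  zero : G
  neg : G → G
  add_assoc : ∀ a b c, add (add a b) c = add a (add b c)
  add_comm : ∀ a b, add a b = add b a
  zero_add : ∀ a, add zero a = a
  neg_add_cancel : ∀ a, add (neg a) a = zero
  brace : ∀ a b c, add (a * add b c) a = add (a * b) (a * c)

namespace SymmetricGroup

variable {G : Type u} [Group G] (B : SymmetricGroup G)

theorem m3 (u v : G) : lact B.r u v * ract B.r u v = u * v :=
  (B.isBraidingOperator.m3 u v).symm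

theorem ml1 (a b u : G) : lact B.r a (lact B.r b u) = lact B.r (a * b) u :=
  (B.isBraidingOperator.ml1 a b u).symm

theorem mr1 (a u v : G) : ract B.r (ract B.r a u) v = ract B.r a (u * v) :=
  (B.isBraidingOperator.mr1 a u v).symm

theorem lact_inv (a u : G) : lact B.r a (lact B.r a⁻¹ u) = u := by
  rw [ml1, mul_inv_cancel, B.isBraidingOperator.ml0']

theorem inv_lact (a u : G) : lact B.r a⁻¹ (lact B.r a u) = u := by
  rw [ml1, inv_mul_cancel, B.isBraidingOperator.ml0']

/-- A symmetric group is an involutive non-degenerate solution. -/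
def toSolution : Solution G where
  r := B.r
  involutive := B.involutive
  left_bijective x := Function.bijective_iff_has_inverse.2
    ⟨fun y => lact B.r x⁻¹ y, fun y => B.inv_lact x y, fun y => B.lact_inv x y⟩
  right_bijective x := Function.bijective_iff_has_inverse.2
    ⟨fun y => ract B.r y x⁻¹,
      fun y => by
        change ract B.r (ract B.r y x) x⁻¹ = y
        rw [mr1, mul_inv_cancel, B.isBraidingOperator.mr0'],
      fun y => by
        change ract B.r (ract B.r y x⁻¹) x = y
        rw [mr1, inv_mul_cancel, B.isBraidingOperator.mr0']⟩
  braid := by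
    rintro ⟨a, b, c⟩
    have h1 : lact B.r (lact B.r a b) (lact B.r (ract B.r a b) c) =
        lact B.r a (lact B.r b c) := by rw [ml1, ml1, m3]
    have h3 : ract B.r (ract B.r a b) c =
        ract B.r (ract B.r a (lact B.r b c)) (ract B.r b c) := by rw [mr1, mr1, m3]
    have h2 : ract B.r (lact B.r a b) (lact B.r (ract B.r a b) c) =
        lact B.r (ract B.r a (lact B.r b c)) (ract B.r b c) := by
      have e1 : lact B.r (lact B.r a b) (lact B.r (ract B.r a b) c) *
          ract B.r (lact B.r a b) (lact B.r (ract B.r a b) c) *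
          ract B.r (ract B.r a b) c = a * b * c := by
        rw [m3, mul_assoc, m3, ← mul_assoc, m3]
      have e2 : lact B.r a (lact B.r b c) *
          lact B.r (ract B.r a (lact B.r b c)) (ract B.r b c) *
          ract B.r (ract B.r a (lact B.r b c)) (ract B.r b c) = a * b * c := by
        rw [mul_assoc, m3, ← mul_assoc, m3, mul_assoc, m3, mul_assoc]
      rw [← e2, h1, h3] at e1
      exact mul_left_cancel (mul_right_cancel e1)
    exact Prod.ext h1 (Prod.ext h2 h3)

theorem lact_mul_lact_inv (a b c : G) :
    lact B.r a (b * lact B.r b⁻¹ c) =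
      lact B.r a b * lact B.r (lact B.r a b)⁻¹ (lact B.r a c) := by
  rw [B.isBraidingOperator.ml2, ml1, ml1]
  have h : ract B.r a b * b⁻¹ = (lact B.r a b)⁻¹ * a := by
    rw [eq_inv_mul_iff_mul_eq, ← mul_assoc, m3, mul_inv_cancel_right]
  rw [h]

theorem add_comm_aux (a b : G) : a * lact B.r a⁻¹ b = b * lact B.r b⁻¹ a := by
  have h := B.m3 a (lact B.r a⁻¹ b)
  have h2 : lact B.r (lact B.r a (lact B.r a⁻¹ b)) (ract B.r a (lact B.r a⁻¹ b)) = a :=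
    B.toSolution.ll a (lact B.r a⁻¹ b)
  rw [lact_inv] at h h2
  rw [← h]
  conv_rhs => rw [← h2]
  rw [inv_lact]

theorem add_assoc_aux (a b c : G) :
    (a * lact B.r a⁻¹ b) * lact B.r (a * lact B.r a⁻¹ b)⁻¹ c =
      a * lact B.r a⁻¹ (b * lact B.r b⁻¹ c) := by
  rw [lact_mul_lact_inv, ml1, mul_inv_rev, mul_assoc]

/-- The left brace associated to a symmetric group: `a + b = a · (^{a⁻¹} b)`. -/
def brace : LeftBrace G where
  add a b := a * lact B.r a⁻¹ b
  zero := 1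
  neg a := lact B.r a a⁻¹
  add_assoc a b c := B.add_assoc_aux a b c
  add_comm a b := B.add_comm_aux a b
  zero_add a := by simp only [inv_one, one_mul, B.isBraidingOperator.ml0']
  neg_add_cancel a := by
    rw [B.add_comm_aux, inv_lact, mul_inv_cancel]
  brace a b c := by
    have key : ∀ u, a * u = a * lact B.r a⁻¹ (lact B.r a u) := fun u => by rw [inv_lact]
    have laut := B.lact_mul_lact_inv a b c
    have assoc := B.add_assoc_aux
    have comm := B.add_comm_aux
    rw [key (b * lact B.r b⁻¹ c), laut, key b, key c]
    generalize lact B.r a b = p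
    generalize lact B.r a c = q
    generalize hs : (fun u v => u * lact B.r u⁻¹ v) = s
    have hs' : ∀ u v, u * lact B.r u⁻¹ v = s u v := fun u v => by rw [← hs]
    simp only [hs'] at assoc comm ⊢
    rw [assoc, assoc, assoc, comm q a]

/-- Condition **Raut** on the left brace of a symmetric group: `(a + b)ᶜ = aᶜ + bᶜ`. -/
def Raut : Prop :=
  ∀ a b c, ract B.r (B.brace.add a b) c = B.brace.add (ract B.r a c) (ract B.r b c)

end SymmetricGroup

namespace Solution

variable {X : Type u} (S : Solution X)

/-- The defining relations `x y = (ˣy) (xʸ)` of the structure group. -/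
def rels : Set (FreeGroup X) :=
  {w | ∃ x y, w = FreeGroup.of x * FreeGroup.of y *
    (FreeGroup.of (lact S.r x y) * FreeGroup.of (ract S.r x y))⁻¹}

/-- The structure group `G(X, r)`. -/
abbrev StructureGroup : Type u := PresentedGroup S.rels

/-- The canonical map `X → G(X, r)`. -/
def ι (x : X) : S.StructureGroup := PresentedGroup.of x

theorem ι_rel (x y : X) : S.ι x * S.ι y = S.ι (lact S.r x y) * S.ι (ract S.r x y) := by
  rw [← mul_inv_eq_one]
  exact PresentedGroup.one_of_mem ⟨x, y, rfl⟩

theorem closure_ι : Subgroup.closure (Set.range S.ι) = ⊤ :=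
  PresentedGroup.closure_range_of S.rels

/-- A map of `X` to a group that respects the defining relations extends to `G(X, r)`. -/
def lift {H : Type*} [Group H] (f : X → H)
    (hf : ∀ x y, f x * f y = f (lact S.r x y) * f (ract S.r x y)) : S.StructureGroup →* H :=
  PresentedGroup.toGroup (f := f) (by
    rintro _ ⟨x, y, rfl⟩
    rw [map_mul, map_mul, map_inv, map_mul, mul_inv_eq_one]
    simpa only [FreeGroup.lift_apply_of] using hf x y)

@[simp] theorem lift_ι {H : Type*} [Group H] (f : X → H)
    (hf : ∀ x y, f x * f y = f (lact S.r x y) * f (ract S.r x y)) (x : X) :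
    S.lift f hf (S.ι x) = f x :=
  PresentedGroup.toGroup.of _

/-- The left action of `G(X, r)` on `X`, extending `x ↦ 𝓛ₓ`. -/
noncomputable def act : S.StructureGroup →* Equiv.Perm X := S.lift S.L S.L_mul

@[simp] theorem act_ι (x : X) : S.act (S.ι x) = S.L x := S.lift_ι _ _ _

/-- The additive action of a permutation of `X` on the free abelian group on `X`. -/
noncomputable def permAct (σ : Equiv.Perm X) : (X →₀ ℤ) ≃+ (X →₀ ℤ) := Finsupp.domCongr σ

@[simp] theorem permAct_single (σ : Equiv.Perm X) (x : X) (n : ℤ) :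
    permAct σ (Finsupp.single x n) = Finsupp.single (σ x) n := by
  simp [permAct]

theorem permAct_mul (σ τ : Equiv.Perm X) (a : X →₀ ℤ) :
    permAct (σ * τ) a = permAct σ (permAct τ a) := by
  ext x; simp only [permAct, Finsupp.domCongr_apply, Finsupp.equivMapDomain_apply]; rfl

theorem permAct_one (a : X →₀ ℤ) : permAct 1 a = a := by
  ext x; simp only [permAct, Finsupp.domCongr_apply, Finsupp.equivMapDomain_apply]; rfl

/-- The affine action of `G(X, r)` on the free abelian group on `X`: `x` acts by
`a ↦ x + 𝓛ₓ a`. -/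
noncomputable def aff : S.StructureGroup →* Equiv.Perm (X →₀ ℤ) :=
  S.lift (fun x => (permAct (S.L x)).toEquiv.trans (Equiv.addLeft (Finsupp.single x 1)))
    (by
      intro x y
      ext1 a
      simp only [Equiv.Perm.mul_apply, Equiv.trans_apply, AddEquiv.toEquiv_eq_coe,
        AddEquiv.coe_toEquiv, Equiv.coe_addLeft, map_add, permAct_single, ← permAct_mul,
        L_apply, S.ll, S.L_mul x y]
      abel)

/-- The bijective 1-cocycle `π : G(X, r) → ℤ^(X)` with `π x = x`, `π (g h) = π g + ᵍ(π h)`. -/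
noncomputable def cocycle (g : S.StructureGroup) : X →₀ ℤ := S.aff g 0

theorem aff_ι (x : X) (a : X →₀ ℤ) :
    S.aff (S.ι x) a = Finsupp.single x 1 + permAct (S.L x) a := by
  simp [aff]

theorem aff_apply (g : S.StructureGroup) (a : X →₀ ℤ) :
    S.aff g a = S.cocycle g + permAct (S.act g) a := by
  have hg : g ∈ Subgroup.closure (Set.range S.ι) := by rw [closure_ι]; trivial
  induction hg using Subgroup.closure_induction generalizing a with
  | mem _ h => obtain ⟨x, rfl⟩ := h; simp [cocycle, aff_ι]
  | one => simp [cocycle, permAct_one]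
  | mul g h _ _ ihg ihh =>
    rw [cocycle, map_mul, map_mul, Equiv.Perm.mul_apply, Equiv.Perm.mul_apply, ihg, ihh, ihg,
      ihh 0, map_add, map_add, permAct_mul, map_zero, map_zero]
    abel
  | inv g _ ih =>
    have h0 : ∀ c, S.aff g (S.aff g⁻¹ c) = c := fun c => by
      rw [← Equiv.Perm.mul_apply, ← map_mul, mul_inv_cancel, map_one, Equiv.Perm.one_apply]
    apply (S.aff g).injective
    rw [h0, ih, map_add, ← permAct_mul, ← map_mul, mul_inv_cancel, map_one, permAct_one,
      ← add_assoc, ← ih, cocycle, h0, zero_add]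

theorem cocycle_mul (g h : S.StructureGroup) :
    S.cocycle (g * h) = S.cocycle g + permAct (S.act g) (S.cocycle h) := by
  rw [← aff_apply, cocycle, cocycle, map_mul, Equiv.Perm.mul_apply]

theorem cocycle_one : S.cocycle 1 = 0 := by simp [cocycle]

@[simp] theorem cocycle_ι (x : X) : S.cocycle (S.ι x) = Finsupp.single x 1 := by
  simp [cocycle, aff_ι]

theorem act_inv_mul_ι (g : S.StructureGroup) (p y : X) :
    S.act (g * S.ι p)⁻¹ y = (S.L p).symm (S.act g⁻¹ y) := by
  rw [mul_inv_rev, map_mul, Equiv.Perm.mul_apply, map_inv, act_ι]; rfl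

/-- The permutation `g ↦ g + x` of `G(X, r)`. -/
noncomputable def shift (x : X) : Equiv.Perm S.StructureGroup where
  toFun g := g * S.ι (S.act g⁻¹ x)
  invFun g := g * (S.ι (S.diag.symm (S.act g⁻¹ x)))⁻¹
  left_inv g := by
    simp only [act_inv_mul_ι, ← diag_apply, Equiv.symm_apply_apply, mul_inv_cancel_right]
  right_inv g := by
    have h : S.act (g * (S.ι (S.diag.symm (S.act g⁻¹ x)))⁻¹)⁻¹ x =
        S.diag.symm (S.act g⁻¹ x) := by
      rw [mul_inv_rev, inv_inv, map_mul, Equiv.Perm.mul_apply, act_ι]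
      generalize S.act g⁻¹ x = y
      rw [← Equiv.eq_symm_apply, ← diag_apply, Equiv.apply_symm_apply]
    simp only [h, inv_mul_cancel_right]

theorem shift_apply (x : X) (g : S.StructureGroup) : S.shift x g = g * S.ι (S.act g⁻¹ x) := rfl

theorem shift_comm (x y : X) : S.shift x * S.shift y = S.shift y * S.shift x := by
  ext g
  simp only [Equiv.Perm.mul_apply, shift_apply, act_inv_mul_ι]
  generalize S.act g⁻¹ x = p
  generalize S.act g⁻¹ y = q
  rw [mul_assoc, mul_assoc, ι_rel, ract_eq]
  have h : lact S.r q ((S.L q).symm p) = p := (S.L q).apply_symm_apply p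
  rw [h]

theorem cocycle_bijective : Function.Bijective S.cocycle := by
  have hcomm : ∀ a ∈ Set.range S.shift, ∀ b ∈ Set.range S.shift, a * b = b * a := by
    rintro _ ⟨x, rfl⟩ _ ⟨y, rfl⟩
    exact S.shift_comm x y
  have hcl := Subgroup.isMulCommutative_closure hcomm
  let : CommGroup (Subgroup.closure (Set.range S.shift)) :=
    { (inferInstance : Group (Subgroup.closure (Set.range S.shift))) with
      mul_comm := hcl.is_comm.comm }
  let τ : (X →₀ ℤ) →+ Additive (Subgroup.closure (Set.range S.shift)) :=
    Finsupp.liftAddHom fun x => zmultiplesHom _ (Additive.ofMul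
      ⟨S.shift x, Subgroup.subset_closure ⟨x, rfl⟩⟩)
  have hτ : ∀ x, ((τ (Finsupp.single x 1)).toMul : Equiv.Perm S.StructureGroup) = S.shift x := by
    intro x; simp [τ]
  have hτadd : ∀ a b, ((τ (a + b)).toMul : Equiv.Perm S.StructureGroup) =
      (τ b).toMul * (τ a).toMul := by
    intro a b; rw [add_comm, map_add]; rfl
  let s : (X →₀ ℤ) → S.StructureGroup := fun a =>
    ((τ a).toMul : Equiv.Perm S.StructureGroup) 1
  have hs : ∀ a x, s (a + Finsupp.single x 1) = S.shift x (s a) := by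
    intro a x
    simp only [s]
    rw [hτadd, hτ, Equiv.Perm.mul_apply]
  have hleft : ∀ g, s (S.cocycle g) = g := by
    intro g
    have hg : g ∈ Subgroup.closure (Set.range S.ι) := by rw [closure_ι]; trivial
    induction hg using Subgroup.closure_induction_right with
    | one => rw [cocycle_one]; simp [s]
    | mul_right g _ _ h ih =>
      obtain ⟨x, rfl⟩ := h
      rw [cocycle_mul, cocycle_ι, permAct_single, hs, ih, shift_apply, ← Equiv.Perm.mul_apply,
        ← map_mul, inv_mul_cancel, map_one, Equiv.Perm.one_apply]
    | mul_inv_cancel g _ _ h ih =>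
      obtain ⟨x, rfl⟩ := h
      have e : S.cocycle g = S.cocycle (g * (S.ι x)⁻¹) +
          Finsupp.single (S.act (g * (S.ι x)⁻¹) x) 1 := by
        conv_lhs => rw [← inv_mul_cancel_right g (S.ι x)]
        rw [cocycle_mul, cocycle_ι, permAct_single]
      rw [e, hs] at ih
      apply (S.shift _).injective
      rw [ih, shift_apply, ← Equiv.Perm.mul_apply, ← map_mul, inv_mul_cancel, map_one,
        Equiv.Perm.one_apply, inv_mul_cancel_right]
  have hshift : ∀ x g, S.cocycle (S.shift x g) = S.cocycle g + Finsupp.single x 1 := by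
    intro x g
    rw [shift_apply, cocycle_mul, cocycle_ι, permAct_single, ← Equiv.Perm.mul_apply,
      ← map_mul, mul_inv_cancel, map_one, Equiv.Perm.one_apply]
  refine ⟨Function.LeftInverse.injective hleft, fun a => ?_⟩
  have key : ∀ (x : X) (n : ℤ) (b : X →₀ ℤ), b ∈ Set.range S.cocycle →
      b + Finsupp.single x n ∈ Set.range S.cocycle := by
    intro x n
    induction n using Int.induction_on with
    | zero => intro b hb; simpa using hb
    | succ n ih =>
      intro b hb
      obtain ⟨g, hg⟩ := ih b hb
      refine ⟨S.shift x g, ?_⟩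
      rw [hshift, hg, Finsupp.single_add]; abel
    | pred n ih =>
      intro b hb
      obtain ⟨g, hg⟩ := ih b hb
      refine ⟨(S.shift x).symm g, ?_⟩
      have := hshift x ((S.shift x).symm g)
      rw [Equiv.apply_symm_apply, hg] at this
      rw [Finsupp.single_sub, ← add_sub_assoc, this, add_sub_cancel_right]
  induction a using Finsupp.induction with
  | zero => exact ⟨1, S.cocycle_one⟩
  | single_add x n a _ _ ih => rw [add_comm]; exact key x n a ih

/-- The cocycle as a bijection. -/
noncomputable def cocycleEquiv : S.StructureGroup ≃ (X →₀ ℤ) :=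
  Equiv.ofBijective S.cocycle S.cocycle_bijective

/-- The left action of `G(X, r)` on itself, transported from its action on `ℤ^(X)`. -/
noncomputable def gLeft (a b : S.StructureGroup) : S.StructureGroup :=
  S.cocycleEquiv.symm (permAct (S.act a) (S.cocycle b))

@[simp] theorem cocycle_gLeft (a b : S.StructureGroup) :
    S.cocycle (S.gLeft a b) = permAct (S.act a) (S.cocycle b) :=
  S.cocycleEquiv.apply_symm_apply _

/-- `r_G (a, b) = (ᵃb, aᵇ)`, where `aᵇ` is `^{(ᵃb)⁻¹} a`. -/
noncomputable def gMap (p : S.StructureGroup × S.StructureGroup) :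
    S.StructureGroup × S.StructureGroup :=
  (S.gLeft p.1 p.2, S.gLeft (S.gLeft p.1 p.2)⁻¹ p.1)

theorem gLeft_mul (a b u : S.StructureGroup) :
    S.gLeft (a * b) u = S.gLeft a (S.gLeft b u) := by
  apply S.cocycle_bijective.1
  simp [permAct_mul]

theorem gLeft_one (u : S.StructureGroup) : S.gLeft 1 u = u := by
  apply S.cocycle_bijective.1
  simp [permAct_one]

theorem gLeft_self_inv (a u : S.StructureGroup) : S.gLeft a (S.gLeft a⁻¹ u) = u := by
  rw [← gLeft_mul, mul_inv_cancel, gLeft_one]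

theorem gM3 (a b : S.StructureGroup) :
    S.gLeft a b * S.gLeft (S.gLeft a b)⁻¹ a = a * b := by
  apply S.cocycle_bijective.1
  rw [cocycle_mul, ← cocycle_gLeft, gLeft_self_inv, cocycle_mul, cocycle_gLeft, add_comm]

theorem gML2 (a u v : S.StructureGroup) :
    S.gLeft a (u * v) = S.gLeft a u * S.gLeft (S.gLeft (S.gLeft a u)⁻¹ a) v := by
  apply S.cocycle_bijective.1
  rw [cocycle_gLeft, cocycle_mul, cocycle_mul, map_add, cocycle_gLeft, cocycle_gLeft,
    ← permAct_mul, ← permAct_mul, ← map_mul, ← map_mul, gM3]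

theorem gMap_involutive : Function.Involutive S.gMap := by
  rintro ⟨a, b⟩
  have h : S.gLeft (S.gLeft a b) (S.gLeft (S.gLeft a b)⁻¹ a) = a := S.gLeft_self_inv _ _
  simp only [gMap, h]
  rw [← gLeft_mul, inv_mul_cancel, gLeft_one]

theorem gMap_isBraidingOperator : IsBraidingOperator S.gMap where
  bijective := S.gMap_involutive.bijective
  ml0 a := by
    change S.gLeft a 1 = 1
    apply S.cocycle_bijective.1
    simp [cocycle_one]
  ml0' := S.gLeft_one
  mr0 u := by
    change S.gLeft _ 1 = 1
    apply S.cocycle_bijective.1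
    simp [cocycle_one]
  mr0' a := by
    have h : S.gLeft a 1 = 1 := by
      apply S.cocycle_bijective.1
      simp [cocycle_one]
    change S.gLeft (S.gLeft a 1)⁻¹ a = a
    rw [h, inv_one, gLeft_one]
  ml1 := S.gLeft_mul
  mr1 a u v := by
    have h1 := S.gM3 a (u * v)
    rw [← mul_assoc, ← S.gM3 a u, mul_assoc _ _ v,
      ← S.gM3 (S.gLeft (S.gLeft a u)⁻¹ a) v, ← mul_assoc, ← gML2] at h1
    exact mul_left_cancel h1
  ml2 := S.gML2
  mr2 a b u := by
    have h1 := S.gM3 (a * b) u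
    rw [mul_assoc, ← S.gM3 b u, ← mul_assoc a, ← S.gM3 a (S.gLeft b u), mul_assoc] at h1
    conv at h1 => lhs; arg 1; rw [gLeft_mul]
    exact mul_left_cancel h1
  m3 u v := (S.gM3 u v).symm

/-- The symmetric group `(G, r_G)` associated to `(X, r)`. -/
noncomputable def symmetricGroup : SymmetricGroup S.StructureGroup where
  r := S.gMap
  isBraidingOperator := S.gMap_isBraidingOperator
  involutive := S.gMap_involutive

/-- `r_G` restricts to `r` on `X × X`. -/
theorem symmetricGroup_r_ι (x y : X) :
    S.symmetricGroup.r (S.ι x, S.ι y) = (S.ι (lact S.r x y), S.ι (ract S.r x y)) := by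
  have h : S.gLeft (S.ι x) (S.ι y) = S.ι (lact S.r x y) := by
    apply S.cocycle_bijective.1
    simp
  refine Prod.ext h ?_
  change S.gLeft (S.gLeft (S.ι x) (S.ι y))⁻¹ (S.ι x) = S.ι (ract S.r x y)
  have h2 := S.gM3 (S.ι x) (S.ι y)
  rw [h, ι_rel] at h2
  rw [h]
  exact mul_left_cancel h2

theorem ι_injective : Function.Injective S.ι := by
  intro x y h
  have := congrArg S.cocycle h
  simpa using (Finsupp.single_left_injective (one_ne_zero (α := ℤ))) (by simpa using this)

/-- `r_G` is the only braiding operator on `G(X, r)` that restricts to `r` on `X × X`. -/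
theorem braidingOperator_unique (ρ : S.StructureGroup × S.StructureGroup →
      S.StructureGroup × S.StructureGroup) (hρ : IsBraidingOperator ρ)
    (hext : ∀ x y, ρ (S.ι x, S.ι y) = (S.ι (lact S.r x y), S.ι (ract S.r x y))) :
    ρ = S.symmetricGroup.r := by
  have hG : IsBraidingOperator S.symmetricGroup.r := S.symmetricGroup.isBraidingOperator
  have hextG := S.symmetricGroup_r_ι
  generalize S.symmetricGroup.r = γ at hG hextG
  have step1 : ∀ u, ∃ σ : Equiv.Perm X, ∀ x, ract ρ (S.ι x) u = S.ι (σ x) ∧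
      ract γ (S.ι x) u = S.ι (σ x) ∧ lact ρ (S.ι x) u = lact γ (S.ι x) u := by
    intro u
    have hu : u ∈ Subgroup.closure (Set.range S.ι) := by rw [closure_ι]; trivial
    induction hu using Subgroup.closure_induction with
    | mem _ h =>
      obtain ⟨y, rfl⟩ := h
      exact ⟨S.R y, fun x => by simp [lact, ract, hext, hextG]⟩
    | one => exact ⟨1, fun x => by simp [hρ.mr0', hG.mr0', hρ.ml0, hG.ml0]⟩
    | mul u v _ _ ihu ihv =>
      obtain ⟨σ, hσ⟩ := ihu
      obtain ⟨τ, hτ⟩ := ihv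
      refine ⟨τ * σ, fun x => ?_⟩
      obtain ⟨h1, h2, h3⟩ := hσ x
      obtain ⟨k1, k2, k3⟩ := hτ (σ x)
      refine ⟨?_, ?_, ?_⟩
      · rw [hρ.mr1, h1, k1]; rfl
      · rw [hG.mr1, h2, k2]; rfl
      · rw [hρ.ml2, hG.ml2, h1, h2, h3, k3]
    | inv u _ ih =>
      obtain ⟨σ, hσ⟩ := ih
      refine ⟨σ⁻¹, fun x => ?_⟩
      obtain ⟨h1, h2, h3⟩ := hσ (σ⁻¹ x)
      have h0 : σ (σ⁻¹ x) = x := σ.apply_symm_apply x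
      rw [h0] at h1 h2
      have e1 : ract ρ (S.ι x) u⁻¹ = S.ι (σ⁻¹ x) := by
        rw [← h1, ← hρ.mr1, mul_inv_cancel, hρ.mr0']
      have e2 : ract γ (S.ι x) u⁻¹ = S.ι (σ⁻¹ x) := by
        rw [← h2, ← hG.mr1, mul_inv_cancel, hG.mr0']
      refine ⟨e1, e2, ?_⟩
      have f1 := hρ.ml2 (S.ι x) u⁻¹ u
      have f2 := hG.ml2 (S.ι x) u⁻¹ u
      rw [inv_mul_cancel, hρ.ml0, e1, h3] at f1
      rw [inv_mul_cancel, hG.ml0, e2] at f2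
      exact mul_right_cancel (f1.symm.trans f2)
  have step2 : ∀ g u, lact ρ g u = lact γ g u := by
    intro g
    have hg : g ∈ Subgroup.closure (Set.range S.ι) := by rw [closure_ι]; trivial
    induction hg using Subgroup.closure_induction with
    | mem _ h =>
      obtain ⟨x, rfl⟩ := h
      intro u
      obtain ⟨σ, hσ⟩ := step1 u
      exact (hσ x).2.2
    | one => intro u; rw [hρ.ml0', hG.ml0']
    | mul g h _ _ ihg ihh => intro u; rw [hρ.ml1, hG.ml1, ihg, ihh]
    | inv g _ ih =>
      intro u
      have e : u = lact ρ g (lact γ g⁻¹ u) := by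
        rw [ih, ← hG.ml1, mul_inv_cancel, hG.ml0']
      conv_lhs => rw [e]
      rw [← hρ.ml1, inv_mul_cancel, hρ.ml0']
  funext p
  obtain ⟨a, b⟩ := p
  refine Prod.ext (step2 a b) ?_
  have h1 := hρ.m3 a b
  rw [hG.m3 a b, step2 a b] at h1
  exact (mul_left_cancel h1).symm

/-- `(G, r_G)` as a solution. -/
noncomputable abbrev groupSolution : Solution S.StructureGroup := S.symmetricGroup.toSolution

/-- `G` acts nontrivially on itself as automorphisms:
`𝓛_{aᵇ} = 𝓛ₐ` for all `a, b ∈ G`, and `𝓛ₐ ≠ id` for some `a ∈ G`. -/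
def ActsNontriviallyByAutomorphisms : Prop :=
  (∀ a b, S.groupSolution.L (ract S.symmetricGroup.r a b) = S.groupSolution.L a) ∧
    ∃ a, S.groupSolution.L a ≠ Equiv.refl S.StructureGroup

end Solution

end YangBaxter

/-!
Everything is read off from whether `Ret (G, r_G)` is trivial, that is, whether `𝓛_{ᵃb} = 𝓛_b`, or
equivalently `𝓛_{aᵇ} = 𝓛ₐ`, for all `a, b`. Since `1` acts as the identity on `G`, and hence so does
its class on `Ret (G, r_G)`, either of these two solutions is trivial exactly when its retraction
is a point. As `aᵇ = ^{(ᵃb)⁻¹} a`, triviality of the retraction implies **lri**, which on `G` reads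
`aᵇ = ^{b⁻¹} a`.

The converse uses that `(G, +)` is free abelian on `X`. Condition **lri** says that `(ᵃb)⁻¹` and
`b⁻¹` move `a` in the same way, and two permutations of `X` that move an element of `ℤ^(X)` in the
same way agree at each point whose coefficient occurs only once, such as `y` in `2y` and in
`2y + w`.

Under **Raut** both `a ↦ aᶜ` and `a ↦ ^{c⁻¹} a` are additive, so for `c` in `X` they agree as soon
as they agree on `X`; the `c` for which they agree form a subgroup.
-/

namespace YangBaxter

namespace Solution

variable {X : Type u} (S : Solution X)

theorem isTrivial_iff_lact : S.IsTrivial ↔ ∀ x y, lact S.r x y = y := by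
  refine ⟨fun h x y => congrArg Prod.fst (h x y), fun h x y => Prod.ext (h x y) ?_⟩
  rw [← h (lact S.r x y) (S.r (x, y)).2]
  exact S.ll x y

theorem isTrivial_iff_ract : S.IsTrivial ↔ ∀ x y, ract S.r x y = x := by
  refine ⟨fun h x y => congrArg Prod.snd (h x y), fun h x y => Prod.ext ?_ (h x y)⟩
  rw [← h (S.r (x, y)).1 (ract S.r x y)]
  exact S.rr x y

theorem isTrivial_iff_L_eq_one : S.IsTrivial ↔ ∀ x, S.L x = 1 := by
  simp only [isTrivial_iff_lact, Equiv.ext_iff, L_apply, Equiv.Perm.one_apply]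

theorem lri_iff_ract_eq_symm : S.Lri ↔ ∀ x y, ract S.r x y = (S.L y).symm x := by
  refine ⟨fun h x y => (Equiv.eq_symm_apply _).2 (h y x).2, fun h x y => ⟨?_, ?_⟩⟩
  · rw [h, ← L_apply, Equiv.symm_apply_apply]
  · rw [h, ← L_apply, Equiv.apply_symm_apply]

theorem retract_isTrivial_iff_L_lact :
    S.retract.IsTrivial ↔ ∀ x y, S.L (lact S.r x y) = S.L y := by
  rw [isTrivial_iff_lact, Quotient.forall]
  simp only [Quotient.forall]
  exact forall₂_congr fun _ _ => Quotient.eq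

theorem retract_isTrivial_iff_L_ract :
    S.retract.IsTrivial ↔ ∀ x y, S.L (ract S.r x y) = S.L x := by
  rw [isTrivial_iff_ract, Quotient.forall]
  simp only [Quotient.forall]
  exact forall₂_congr fun _ _ => Quotient.eq

theorem lri_of_retract_isTrivial (h : S.retract.IsTrivial) : S.Lri := by
  rw [retract_isTrivial_iff_L_lact] at h
  rw [lri_iff_ract_eq_symm]
  intro x y
  rw [ract_eq, h]

variable {S} in
theorem RetIsPoint.succ {m : ℕ} (h : RetIsPoint m S) : RetIsPoint (m + 1) S := by
  induction m generalizing X with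
  | zero =>
    obtain ⟨x, hx⟩ := Nat.card_eq_one_iff_exists.1 h
    exact Nat.card_eq_one_iff_exists.2 ⟨Quotient.mk _ x, Quotient.ind fun y => by rw [hx y]⟩
  | succ m ih => exact ih h

variable {S} in
theorem RetIsPoint.mono {m n : ℕ} (hmn : m ≤ n) (h : RetIsPoint m S) : RetIsPoint n S :=
  Nat.le_induction h (fun _ _ => RetIsPoint.succ) n hmn

theorem hasMpl_succ_iff {m : ℕ} :
    S.HasMpl (m + 1) ↔ RetIsPoint (m + 1) S ∧ ¬ RetIsPoint m S := by
  refine and_congr_right fun _ => ⟨fun h hm => Nat.not_succ_le_self m (h hm), fun h k hk => ?_⟩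
  by_contra! hlt
  exact h (hk.mono (Nat.le_of_lt_succ hlt))

variable {S} in
theorem RetIsPoint.exists_hasMpl {n : ℕ} (h : RetIsPoint n S) : ∃ m, m ≤ n ∧ S.HasMpl m := by
  classical
  have hex : ∃ m, RetIsPoint m S := ⟨n, h⟩
  exact ⟨Nat.find hex, Nat.find_min' hex h, Nat.find_spec hex, fun _ => Nat.find_min' hex⟩

theorem retIsPoint_one_iff : RetIsPoint 1 S ↔ ∃ x, ∀ y, S.L y = S.L x := by
  change Nat.card (Quotient S.retSetoid) = 1 ↔ _
  rw [Nat.card_eq_one_iff_exists, Quotient.exists]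
  simp only [Quotient.forall]
  exact exists_congr fun _ => forall_congr' fun _ => Quotient.eq

theorem retIsPoint_one_of_isTrivial [hX : Nonempty X] (h : S.IsTrivial) : RetIsPoint 1 S := by
  rw [isTrivial_iff_L_eq_one] at h
  exact S.retIsPoint_one_iff.2 (hX.elim fun x => ⟨x, fun y => by rw [h, h]⟩)

theorem retIsPoint_one_iff_isTrivial {e : X} (he : S.L e = 1) :
    RetIsPoint 1 S ↔ S.IsTrivial := by
  refine ⟨fun h => ?_, have : Nonempty X := ⟨e⟩; S.retIsPoint_one_of_isTrivial⟩
  obtain ⟨x, hx⟩ := S.retIsPoint_one_iff.1 h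
  exact S.isTrivial_iff_L_eq_one.2 fun y => by rw [hx y, ← hx e, he]

theorem retract_L_mk_eq_one {e : X} (he : S.L e = 1) :
    S.retract.L (Quotient.mk S.retSetoid e) = 1 :=
  Equiv.ext <| Quotient.ind fun y =>
    congrArg (Quotient.mk S.retSetoid) (DFunLike.congr_fun he y)

theorem hasMpl_two_iff {e : X} (he : S.L e = 1) :
    S.HasMpl 2 ↔ ¬ S.IsTrivial ∧ S.retract.IsTrivial := by
  rw [hasMpl_succ_iff, S.retIsPoint_one_iff_isTrivial he, and_comm]
  exact and_congr_right' (S.retract.retIsPoint_one_iff_isTrivial (S.retract_L_mk_eq_one he))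

theorem retIsPoint_two_of_retract_isTrivial [hX : Nonempty X] (h : S.retract.IsTrivial) :
    RetIsPoint 2 S :=
  have : Nonempty (Quotient S.retSetoid) := hX.map (Quotient.mk _)
  S.retract.retIsPoint_one_of_isTrivial h

end Solution

namespace SymmetricGroup

variable {G : Type u} [Group G] (B : SymmetricGroup G)

theorem toSolution_L_one : B.toSolution.L 1 = 1 :=
  Equiv.ext B.isBraidingOperator.ml0'

theorem toSolution_lri_iff : B.toSolution.Lri ↔ ∀ a b, ract B.r a b = lact B.r b⁻¹ a := by
  have hsymm : ∀ a b, (B.toSolution.L b).symm a = lact B.r b⁻¹ a := fun a b =>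
    (Equiv.symm_apply_eq _).2 (B.lact_inv b a).symm
  simp only [Solution.lri_iff_ract_eq_symm, hsymm]
  rfl

theorem toSolution_lri_of_closure {s : Set G} (hs : Subgroup.closure s = ⊤)
    (h : ∀ c ∈ s, ∀ a, ract B.r a c = lact B.r c⁻¹ a) : B.toSolution.Lri := by
  rw [toSolution_lri_iff]
  intro a c
  have hc : c ∈ Subgroup.closure s := hs ▸ Subgroup.mem_top c
  induction hc using Subgroup.closure_induction generalizing a with
  | mem c hc => exact h c hc a
  | one => rw [inv_one, B.isBraidingOperator.ml0', B.isBraidingOperator.mr0']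
  | mul u v _ _ ihu ihv => rw [← mr1, ihu, ihv, ml1, mul_inv_rev]
  | inv u _ ih =>
    calc ract B.r a u⁻¹ = ract B.r (ract B.r (lact B.r u a) u) u⁻¹ := by rw [ih, inv_lact]
      _ = lact B.r u⁻¹⁻¹ a := by rw [mr1, mul_inv_cancel, B.isBraidingOperator.mr0', inv_inv]

theorem lact_brace_add (a b c : G) :
    lact B.r c (B.brace.add a b) = B.brace.add (lact B.r c a) (lact B.r c b) :=
  B.lact_mul_lact_inv c a b

theorem raut_of_lri (h : B.toSolution.Lri) : B.Raut := by
  rw [toSolution_lri_iff] at h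
  intro a b c
  rw [h, h, h, lact_brace_add]

end SymmetricGroup

namespace Solution

variable {X : Type u}

theorem apply_eq_of_permAct_eq {σ τ : Equiv.Perm X} {a : X →₀ ℤ} {y : X}
    (ha : ∀ w, a w = a y → w = y) (h : permAct σ a = permAct τ a) : σ y = τ y := by
  have hcoeff : a (σ.symm (σ y)) = a (τ.symm (σ y)) := DFunLike.congr_fun h (σ y)
  rw [Equiv.symm_apply_apply] at hcoeff
  exact (Equiv.symm_apply_eq τ).1 (ha _ hcoeff.symm)

theorem permAct_injective : Function.Injective (permAct (X := X)) := by
  classical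
  intro σ τ h
  ext y
  refine apply_eq_of_permAct_eq (a := Finsupp.single y 1) (fun w hw => ?_) (by rw [h])
  by_contra hne
  simp [Ne.symm hne] at hw

variable (S : Solution X)

theorem gLeft_ι (a : S.StructureGroup) (x : X) : S.gLeft a (S.ι x) = S.ι (S.act a x) :=
  S.cocycle_bijective.1 (by rw [cocycle_gLeft, cocycle_ι, cocycle_ι, permAct_single])

theorem groupSolution_L_eq_iff {a b : S.StructureGroup} :
    S.groupSolution.L a = S.groupSolution.L b ↔ S.act a = S.act b := by
  refine ⟨fun h => permAct_injective (AddEquiv.ext fun v => ?_), fun h => Equiv.ext fun g => ?_⟩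
  · obtain ⟨g, rfl⟩ := S.cocycle_bijective.2 v
    rw [← cocycle_gLeft, ← cocycle_gLeft]
    exact congrArg S.cocycle (DFunLike.congr_fun h g)
  · change S.gLeft a g = S.gLeft b g
    rw [gLeft, gLeft, h]

theorem groupSolution_isTrivial_iff : S.groupSolution.IsTrivial ↔ S.IsTrivial := by
  have hG : S.groupSolution.IsTrivial ↔ S.act = 1 := by
    simp only [isTrivial_iff_L_eq_one, ← S.symmetricGroup.toSolution_L_one,
      groupSolution_L_eq_iff, map_one, DFunLike.ext_iff (f := S.act), MonoidHom.one_apply]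
  rw [hG, isTrivial_iff_L_eq_one]
  exact ⟨fun h x => by rw [← act_ι, h, MonoidHom.one_apply],
    fun h => PresentedGroup.ext fun x => (S.act_ι x).trans (h x)⟩

section Lri

variable {S}

theorem act_gLeft_inv_apply_of_lri (h : S.groupSolution.Lri) {a : S.StructureGroup} {y : X}
    (ha : ∀ w, S.cocycle a w = S.cocycle a y → w = y) (b : S.StructureGroup) :
    S.act (S.gLeft a b)⁻¹ y = S.act b⁻¹ y := by
  have hab : S.gLeft (S.gLeft a b)⁻¹ a = S.gLeft b⁻¹ a :=
    S.symmetricGroup.toSolution_lri_iff.1 h a b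
  exact apply_eq_of_permAct_eq ha (by rw [← cocycle_gLeft, ← cocycle_gLeft, hab])

theorem act_gLeft_ι_of_lri (h : S.groupSolution.Lri) (z : X) (b : S.StructureGroup) :
    S.act (S.gLeft (S.ι z) b) = S.act b := by
  classical
  suffices S.act (S.gLeft (S.ι z) b)⁻¹ = S.act b⁻¹ by rwa [map_inv, map_inv, inv_inj] at this
  ext y
  obtain ⟨u, hu⟩ := S.cocycle_bijective.2 (Finsupp.single y 2)
  have huz : S.cocycle (u * S.ι z) = Finsupp.single y 2 + Finsupp.single (S.act u z) 1 := by
    rw [cocycle_mul, hu, cocycle_ι, permAct_single]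
  have hu_unique : ∀ w, S.cocycle u w = S.cocycle u y → w = y := by
    simp only [hu, Finsupp.single_apply]
    grind
  have huz_unique : ∀ w, S.cocycle (u * S.ι z) w = S.cocycle (u * S.ι z) y → w = y := by
    simp only [huz, Finsupp.add_apply, Finsupp.single_apply]
    grind
  calc S.act (S.gLeft (S.ι z) b)⁻¹ y = S.act (S.gLeft u (S.gLeft (S.ι z) b))⁻¹ y :=
        (act_gLeft_inv_apply_of_lri h hu_unique _).symm
    _ = S.act (S.gLeft (u * S.ι z) b)⁻¹ y := by rw [gLeft_mul]
    _ = S.act b⁻¹ y := act_gLeft_inv_apply_of_lri h huz_unique b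

theorem act_gLeft_of_lri (h : S.groupSolution.Lri) (a b : S.StructureGroup) :
    S.act (S.gLeft a b) = S.act b := by
  have ha : a ∈ Subgroup.closure (Set.range S.ι) := S.closure_ι ▸ Subgroup.mem_top a
  induction ha using Subgroup.closure_induction generalizing b with
  | mem _ hz => obtain ⟨z, rfl⟩ := hz; exact act_gLeft_ι_of_lri h z b
  | one => rw [gLeft_one]
  | mul u v _ _ ihu ihv => rw [gLeft_mul, ihu, ihv]
  | inv u _ ih => rw [← ih (S.gLeft u⁻¹ b), gLeft_self_inv]

end Lri

theorem groupSolution_lri_iff_retract_isTrivial :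
    S.groupSolution.Lri ↔ S.groupSolution.retract.IsTrivial :=
  ⟨fun h => S.groupSolution.retract_isTrivial_iff_L_lact.2 fun a b =>
    S.groupSolution_L_eq_iff.2 (act_gLeft_of_lri h a b), S.groupSolution.lri_of_retract_isTrivial⟩

theorem retract_isTrivial_of_groupSolution_lri (h : S.groupSolution.Lri) :
    S.retract.IsTrivial := by
  rw [retract_isTrivial_iff_L_lact]
  intro x y
  simpa only [gLeft_ι, act_ι, L_apply] using act_gLeft_of_lri h (S.ι x) (S.ι y)

theorem cocycle_brace_add (a b : S.StructureGroup) :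
    S.cocycle (S.symmetricGroup.brace.add a b) = S.cocycle a + S.cocycle b := by
  change S.cocycle (a * S.gLeft a⁻¹ b) = _
  rw [cocycle_mul, ← cocycle_gLeft, gLeft_self_inv]

theorem cocycleEquiv_symm_add (v w : X →₀ ℤ) :
    S.cocycleEquiv.symm (v + w) =
      S.symmetricGroup.brace.add (S.cocycleEquiv.symm v) (S.cocycleEquiv.symm w) := by
  rw [Equiv.symm_apply_eq]
  refine Eq.trans ?_ (S.cocycle_brace_add _ _).symm
  exact congrArg₂ (· + ·) (S.cocycleEquiv.apply_symm_apply v).symm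
    (S.cocycleEquiv.apply_symm_apply w).symm

theorem brace_add_hom_ext {A : Type*} [AddGroup A] {f g : S.StructureGroup → A}
    (hf : ∀ a b, f (S.symmetricGroup.brace.add a b) = f a + f b)
    (hg : ∀ a b, g (S.symmetricGroup.brace.add a b) = g a + g b)
    (h : ∀ x, f (S.ι x) = g (S.ι x)) : f = g := by
  let F : (X →₀ ℤ) →+ A := AddMonoidHom.mk' (f ∘ S.cocycleEquiv.symm) fun v w => by
    simp only [Function.comp_apply, cocycleEquiv_symm_add, hf]
  let F' : (X →₀ ℤ) →+ A := AddMonoidHom.mk' (g ∘ S.cocycleEquiv.symm) fun v w => by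
    simp only [Function.comp_apply, cocycleEquiv_symm_add, hg]
  have hι : ∀ x, S.cocycleEquiv.symm (Finsupp.single x 1) = S.ι x := fun x =>
    (Equiv.symm_apply_eq _).2 (S.cocycle_ι x).symm
  have hF : F = F' := Finsupp.addHom_ext' fun x => AddMonoidHom.ext_int <| by
    change f (S.cocycleEquiv.symm (Finsupp.single x 1)) =
      g (S.cocycleEquiv.symm (Finsupp.single x 1))
    rw [hι, h]
  exact S.cocycleEquiv.symm.surjective.injective_comp_right (congrArg DFunLike.coe hF)

theorem ract_ι_ι_of_lri (h : S.Lri) (x y : X) :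
    ract S.symmetricGroup.r (S.ι x) (S.ι y) = lact S.symmetricGroup.r (S.ι y)⁻¹ (S.ι x) := by
  change (S.symmetricGroup.r (S.ι x, S.ι y)).2 = S.gLeft (S.ι y)⁻¹ (S.ι x)
  rw [symmetricGroup_r_ι, gLeft_ι, map_inv, act_ι, S.lri_iff_ract_eq_symm.1 h]
  rfl

theorem groupSolution_lri_of_lri_of_raut (h : S.Lri) (hR : S.symmetricGroup.Raut) :
    S.groupSolution.Lri := by
  refine S.symmetricGroup.toSolution_lri_of_closure S.closure_ι ?_
  rintro _ ⟨y, rfl⟩ a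
  apply S.cocycle_bijective.1
  refine congrFun (S.brace_add_hom_ext
    (f := fun a => S.cocycle (ract S.symmetricGroup.r a (S.ι y)))
    (g := fun a => S.cocycle (lact S.symmetricGroup.r (S.ι y)⁻¹ a)) (fun a b => ?_)
    (fun a b => ?_) fun x => ?_) a
  · rw [hR, cocycle_brace_add]
  · rw [SymmetricGroup.lact_brace_add, cocycle_brace_add]
  · rw [S.ract_ι_ι_of_lri h]

theorem groupSolution_lri_iff_lri_and_raut :
    S.groupSolution.Lri ↔ S.Lri ∧ S.symmetricGroup.Raut :=
  ⟨fun h => ⟨S.lri_of_retract_isTrivial (S.retract_isTrivial_of_groupSolution_lri h),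
    S.symmetricGroup.raut_of_lri h⟩, fun h => S.groupSolution_lri_of_lri_of_raut h.1 h.2⟩

theorem actsNontriviallyByAutomorphisms_iff :
    S.ActsNontriviallyByAutomorphisms ↔
      ¬ S.groupSolution.IsTrivial ∧ S.groupSolution.retract.IsTrivial := by
  rw [and_comm, retract_isTrivial_iff_L_ract, isTrivial_iff_L_eq_one, not_forall]
  rfl

end Solution

end YangBaxter

theorem theorem3p1 {X : Type*} [Nonempty X] (S : YangBaxter.Solution X) :
    List.TFAE
      [ ¬ S.groupSolution.IsTrivial ∧ S.groupSolution.Lri,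
        S.groupSolution.HasMpl 2,
        S.ActsNontriviallyByAutomorphisms,
        ¬ S.IsTrivial ∧ S.Lri ∧ S.symmetricGroup.Raut ] ∧
    ((¬ S.groupSolution.IsTrivial ∧ S.groupSolution.Lri) ∨
        S.groupSolution.HasMpl 2 ∨
        S.ActsNontriviallyByAutomorphisms ∨
        (¬ S.IsTrivial ∧ S.Lri ∧ S.symmetricGroup.Raut) →
      ∃ m, m ≤ 2 ∧ S.HasMpl m) := by
  have mpl_iff : S.groupSolution.HasMpl 2 ↔
      ¬ S.groupSolution.IsTrivial ∧ S.groupSolution.Lri := by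
    rw [S.groupSolution.hasMpl_two_iff S.symmetricGroup.toSolution_L_one,
      S.groupSolution_lri_iff_retract_isTrivial]
  have aut_iff : S.ActsNontriviallyByAutomorphisms ↔
      ¬ S.groupSolution.IsTrivial ∧ S.groupSolution.Lri := by
    rw [S.actsNontriviallyByAutomorphisms_iff, S.groupSolution_lri_iff_retract_isTrivial]
  have raut_iff : ¬ S.IsTrivial ∧ S.Lri ∧ S.symmetricGroup.Raut ↔
      ¬ S.groupSolution.IsTrivial ∧ S.groupSolution.Lri := by
    rw [S.groupSolution_isTrivial_iff, S.groupSolution_lri_iff_lri_and_raut]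
  rw [mpl_iff, aut_iff, raut_iff]
  refine ⟨by tfae_finish, ?_⟩
  rintro (⟨_, lri⟩ | ⟨_, lri⟩ | ⟨_, lri⟩ | ⟨_, lri⟩) <;>
    exact (S.retIsPoint_two_of_retract_isTrivial
      (S.retract_isTrivial_of_groupSolution_lri lri)).exists_hasMpl
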